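/- **Corollary D.** Let $n\ge 1$ be an integer and let $k,l$ be integers with $\gcd(n,k,l)=1$. Let $G=G_n(x_0x_kx_l)$ be the cyclically presented group $$G=\langle x_0,\dots,x_{n-1}\mid x_ix_{i+k}x_{i+l}=1\ (0\le i<n)\rangle ,$$ subscripts being taken modulo $n$. Consider the conditions - (A) $n\equiv 0 \pmod 3$ and $k+l\equiv 0\pmod 3$; - (C) $3l\equiv 0$ or $3k\equiv 0$ or $3(l-k)\equiv 0 \pmod n$. For integers $M,N,R,\lambda$ with $M,N\geq 1$ and $R^N\equiv 1 \pmod M$ let $$B(M,N,R,\lambda)=\langle a,b\mid a^M=1,\ bab^{-1}=a^R,\ b^N=a^{\lambda M/\gcd(M,R-1)}\rangle ,$$ and let $\mathbb{Z}_m$ denote the cyclic group of order $m$. Suppose that (C) holds. Then, with congruences between $k$, $l$ and $0$ taken modulo $n$, $$ G\cong \begin{cases} B\left(\frac{2^n-(-1)^n}{3},\,3,\,2^{2n/3},\,1\right) & \text{if (A) does not hold and } k\not\equiv 0,\ l\not\equiv 0,\ k\not\equiv l,\\ \mathbb{Z}_{2^n-(-1)^n} & \text{if } k\equiv 0 \text{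 or } l\equiv 0 \text{ or } k\equiv l,\\ \mathbb{Z}_{(2^{n/3}-(-1)^{n/3})/3} * \mathbb{Z} * \mathbb{Z} & \text{if (A) holds.} \end{cases} $$ (In the first and third cases $n$ is divisible by $3$, and all the quotients written above are positive integers.) -/

import Mathlib

namespace CyclicPres

/-- The shift automorphism `θ` of the free group on `x_i` (`i` modulo `n`): `θ (x_i) = x_{i+1}`. -/
def shift (n : ℕ) : FreeGroup (ZMod n) →* FreeGroup (ZMod n) :=
  FreeGroup.map fun i => i + 1

/-- The relators `w, θ(w), …, θ^{n-1}(w)`. -/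
def relators (n : ℕ) (w : FreeGroup (ZMod n)) : Set (FreeGroup (ZMod n)) :=
  {r | ∃ i < n, r = (shift n)^[i] w}

/-- The cyclically presented group `G_n(w)`. -/
abbrev CyclicGroup (n : ℕ) (w : FreeGroup (ZMod n)) : Type :=
  PresentedGroup (relators n w)

/-- The word `x_0 x_k x_l`, subscripts being read modulo `n`. -/
def word (n : ℕ) (k l : ℤ) : FreeGroup (ZMod n) :=
  FreeGroup.of 0 * FreeGroup.of (k : ZMod n) * FreeGroup.of (l : ZMod n)

/-- Condition (A): `n ≡ 0` and `k + l ≡ 0` modulo `3`. -/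
def CondA (n : ℕ) (k l : ℤ) : Prop :=
  (n : ℤ) ≡ 0 [ZMOD 3] ∧ k + l ≡ 0 [ZMOD 3]

/-- Condition (C): `3l ≡ 0` or `3k ≡ 0` or `3(l - k) ≡ 0` modulo `n`. -/
def CondC (n : ℕ) (k l : ℤ) : Prop :=
  3 * l ≡ 0 [ZMOD n] ∨ 3 * k ≡ 0 [ZMOD n] ∨ 3 * (l - k) ≡ 0 [ZMOD n]

/-- The relators of `⟨a, b | a^M = 1, b a b⁻¹ = a^R, b^N = a^(lam * M / (M, R - 1))⟩`,
with `a = of 0` and `b = of 1`. -/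
def metacyclicRelators (M N R lam : ℤ) : Set (FreeGroup (Fin 2)) :=
  let a : FreeGroup (Fin 2) := FreeGroup.of 0
  let b : FreeGroup (Fin 2) := FreeGroup.of 1
  {a ^ M, b * a * b⁻¹ * (a ^ R)⁻¹, b ^ N * (a ^ (lam * (M / (Int.gcd M (R - 1) : ℤ))))⁻¹}

/-- The metacyclic group `B(M, N, R, lam)`. -/
abbrev B (M N R lam : ℤ) : Type :=
  PresentedGroup (metacyclicRelators M N R lam)

/-- The finite cyclic group of order `m` (for `m > 0`), written multiplicatively. -/
abbrev Cyc (m : ℕ) : Type := Multiplicative (ZMod m)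

end CyclicPres

/-! Cyclically permuting the relators turns (k, l) into (l - k, -k) and then (-l, k - l), so (C)
reduces to 3k = 0 mod n. Put s = k + l and W_i = x_i x_{i+k} x_{i+2k}. The relation at i + k says
x_{i+s} = W_i⁻¹ x_i. As 3k = 0, W_{i+k} is conjugate to W_i by x_i, and W_{i+s} = W_i^(-2) follows.
Hence x_{i+js} = W_i^(e_j) x_i with e_j = ((-2)^j - 1)/3 (`IsTripleFamily.apply_add_mul`), and
W_i^(e_m) = 1 whenever ms = 0.

If (A) fails and k ≠ 0, then n = 3m and s is a unit, so W_0 and x_0 generate. After inverting the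
generators if necessary, k = ms; then conjugation by x_0 raises W_0 to a power and x_0³ is a power
of W_0, which is the metacyclic presentation. If (A) holds, ℤ/n is the direct sum of ⟨s⟩, of order m
= n/3, and ⟨k⟩, of order 3; W_0, x_0, x_k generate, with W_0^(e_m) = 1 as only relation. If k = 0,
the relations read x_{i+l} = x_i^(-2) with l a unit, and the group is cyclic. -/

namespace CyclicPres

/-! ### Families satisfying the relations, and symmetries of the parameters -/

section Families

variable {n : ℕ} {Γ : Type*} [Group Γ]

/-- A family of elements indexed modulo `n` satisfies the relations `x_i x_{i+k} x_{i+l} = 1`. -/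
def IsTripleFamily (k l : ZMod n) (x : ZMod n → Γ) : Prop :=
  ∀ i, x i * x (i + k) * x (i + l) = 1

/-- The relator at i - k, cyclically permuted to start with x_i. -/
theorem IsTripleFamily.rotate {k l : ZMod n} {x : ZMod n → Γ} (hx : IsTripleFamily k l x) :
    IsTripleFamily (l - k) (-k) x := by
  intro i
  have h := hx (i - k)
  rw [sub_add_cancel, mul_assoc, mul_eq_one_iff_eq_inv, ← inv_eq_iff_eq_inv,
    show i - k + l = i + (l - k) by ring] at h
  rw [← sub_eq_add_neg i k, ← h, inv_mul_cancel]

/-- The inverse of the relator at i - k, cyclically permuted. When 3k = 0 this changes the sign of k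
while keeping k + l. -/
theorem IsTripleFamily.inv {k l : ZMod n} {x : ZMod n → Γ} (hx : IsTripleFamily k l x) :
    IsTripleFamily (-k) (l - k) (fun i => (x i)⁻¹) := by
  intro i
  have h := hx (i - k)
  rw [sub_add_cancel, mul_eq_one_iff_eq_inv, show i - k + l = i + (l - k) by ring] at h
  rw [← sub_eq_add_neg i k, ← mul_inv_rev, h, inv_inv, mul_inv_cancel]

theorem shift_iterate_word (k l : ℤ) (i : ℕ) :
    (shift n)^[i] (word n k l) =
      FreeGroup.of (i : ZMod n) * FreeGroup.of ((i : ZMod n) + k) *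
        FreeGroup.of ((i : ZMod n) + l) := by
  induction i with
  | zero => simp [word]
  | succ i ih =>
    rw [Function.iterate_succ_apply', ih]
    simp only [shift, map_mul, FreeGroup.map.of, Nat.cast_succ]
    rw [add_right_comm (i : ZMod n) k 1, add_right_comm (i : ZMod n) l 1]

/-- The generator `x_i` of `G_n(x_0 x_k x_l)`. -/
def gen (n : ℕ) (k l : ℤ) (i : ZMod n) : CyclicGroup n (word n k l) :=
  PresentedGroup.of i

theorem isTripleFamily_gen [NeZero n] (k l : ℤ) :
    IsTripleFamily (k : ZMod n) (l : ZMod n) (gen n k l) := by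
  intro i
  have h : (PresentedGroup.mk (relators n (word n k l))) ((shift n)^[i.val] (word n k l)) = 1 :=
    PresentedGroup.one_of_mem ⟨i.val, i.val_lt, rfl⟩
  rw [shift_iterate_word, ZMod.natCast_zmod_val] at h
  rw [map_mul, map_mul] at h
  exact h

/-- The homomorphism out of `G_n(x_0 x_k x_l)` given by a family satisfying its relations. -/
def liftFamily {k l : ℤ} {x : ZMod n → Γ} (hx : IsTripleFamily (k : ZMod n) (l : ZMod n) x) :
    CyclicGroup n (word n k l) →* Γ :=
  PresentedGroup.toGroup (f := x) (by
    rintro r ⟨i, -, rfl⟩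
    rw [shift_iterate_word]
    simpa using hx i)

@[simp]
theorem liftFamily_gen {k l : ℤ} {x : ZMod n → Γ}
    (hx : IsTripleFamily (k : ZMod n) (l : ZMod n) x) (i : ZMod n) :
    liftFamily hx (gen n k l i) = x i :=
  PresentedGroup.toGroup.of _

theorem hom_ext {k l : ℤ} {f g : CyclicGroup n (word n k l) →* Γ}
    (h : ∀ i, f (gen n k l i) = g (gen n k l i)) : f = g :=
  PresentedGroup.ext h

theorem nonempty_mulEquiv_rotate [NeZero n] (k l : ℤ) :
    Nonempty (CyclicGroup n (word n k l) ≃* CyclicGroup n (word n (l - k) (-k))) := by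
  have h₁ : IsTripleFamily (k : ZMod n) (l : ZMod n) (gen n (l - k) (-k)) := by
    -- Rotation has order three on pairs, so two more rotations lead back to (k, l).
    have := (isTripleFamily_gen (n := n) (l - k) (-k)).rotate.rotate
    convert this using 1 <;> push_cast <;> ring
  have h₂ : IsTripleFamily ((l - k : ℤ) : ZMod n) ((-k : ℤ) : ZMod n) (gen n k l) := by
    simpa using (isTripleFamily_gen (n := n) k l).rotate
  exact ⟨(liftFamily h₁).toMulEquiv (liftFamily h₂) (hom_ext fun i => by simp)
    (hom_ext fun i => by simp)⟩

theorem nonempty_mulEquiv_inv [NeZero n] (k l : ℤ) :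
    Nonempty (CyclicGroup n (word n k l) ≃* CyclicGroup n (word n (-k) (l - k))) := by
  have h₁ : IsTripleFamily (k : ZMod n) (l : ZMod n) (fun i => (gen n (-k) (l - k) i)⁻¹) := by
    have := (isTripleFamily_gen (n := n) (-k) (l - k)).inv
    convert this using 1 <;> push_cast <;> ring
  have h₂ : IsTripleFamily ((-k : ℤ) : ZMod n) ((l - k : ℤ) : ZMod n)
      (fun i => (gen n k l i)⁻¹) := by
    simpa using (isTripleFamily_gen (n := n) k l).inv
  exact ⟨(liftFamily h₁).toMulEquiv (liftFamily h₂) (hom_ext fun i => by simp)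
    (hom_ext fun i => by simp)⟩

end Families

/-! ### Arithmetic of the exponents ((-2)^j - 1)/3 -/

section Exponents

/-- The sequence `((-2) ^ j - 1) / 3`. -/
def expo : ℕ → ℤ
  | 0 => 0
  | j + 1 => -2 * expo j - 1

@[simp]
theorem expo_zero : expo 0 = 0 := rfl

theorem expo_succ (j : ℕ) : expo (j + 1) = -2 * expo j - 1 := rfl

theorem three_mul_expo (j : ℕ) : 3 * expo j = (-2) ^ j - 1 := by
  induction j with
  | zero => rfl
  | succ j ih => rw [expo_succ, pow_succ]; linarith

theorem expo_add (i j : ℕ) : expo (i + j) = expo i + (-2) ^ i * expo j := by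
  have h₁ := three_mul_expo (i + j)
  have h₂ := three_mul_expo i
  have h₃ := three_mul_expo j
  rw [pow_add] at h₁
  refine mul_left_cancel₀ (three_ne_zero' ℤ) ?_
  linear_combination h₁ - h₂ - (-2) ^ i * h₃

theorem expo_dvd_expo_mul (m q : ℕ) : expo m ∣ expo (m * q) := by
  induction q with
  | zero => simp
  | succ q ih => rw [Nat.mul_succ, expo_add]; exact ih.add (Dvd.intro_left _ rfl)

/-- Makes g ^ `expo j` depend only on j mod m once g ^ `expo m` = 1. -/
theorem expo_dvd_sub_of_modEq {m i j : ℕ} (h : i ≡ j [MOD m]) : expo m ∣ expo i - expo j := by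
  wlog hij : j ≤ i generalizing i j
  · rw [← dvd_neg, neg_sub]; exact this h.symm (le_of_not_ge hij)
  obtain ⟨q, hq⟩ := (Nat.modEq_iff_dvd' hij).1 h.symm
  obtain rfl : i = j + m * q := by omega
  rw [expo_add, add_sub_cancel_left]
  exact (expo_dvd_expo_mul m q).mul_left _

theorem two_pow_sub_neg_one_pow (j : ℕ) :
    (2 ^ j - (-1) ^ j : ℤ) = (-1) ^ j * (3 * expo j) := by
  rw [three_mul_expo, mul_sub, ← mul_pow]; norm_num

theorem two_pow_sub_neg_one_pow_nonneg (j : ℕ) : (0 : ℤ) ≤ 2 ^ j - (-1) ^ j := by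
  have h₁ : (1 : ℤ) ≤ 2 ^ j := one_le_pow₀ (by norm_num)
  rcases neg_one_pow_eq_or ℤ j with h | h <;> rw [h] <;> linarith

theorem two_pow_sub_neg_one_pow_pos {j : ℕ} (hj : j ≠ 0) : (0 : ℤ) < 2 ^ j - (-1) ^ j := by
  have h₁ : (1 : ℤ) < 2 ^ j := one_lt_pow₀ (by norm_num) hj
  rcases neg_one_pow_eq_or ℤ j with h | h <;> rw [h] <;> linarith

theorem two_pow_sub_neg_one_pow_div_three (j : ℕ) :
    (2 ^ j - (-1) ^ j : ℤ) / 3 = (-1) ^ j * expo j := by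
  rw [two_pow_sub_neg_one_pow, mul_left_comm, Int.mul_ediv_cancel_left _ (by norm_num)]

theorem neg_one_pow_mul_dvd (j : ℕ) (a b : ℤ) : (-1) ^ j * a ∣ b ↔ a ∣ b := by
  rcases neg_one_pow_eq_or ℤ j with h | h <;> simp [h]

theorem zpow_eq_one_of_dvd {Γ : Type*} [Group Γ] {g : Γ} {a b : ℤ} (h : a ∣ b)
    (hg : g ^ a = 1) : g ^ b = 1 := by
  obtain ⟨c, rfl⟩ := h
  rw [zpow_mul, hg, one_zpow]

theorem zpow_eq_zpow_of_dvd_sub {Γ : Type*} [Group Γ] {g : Γ} {a b c : ℤ} (h : a ∣ b - c)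
    (hg : g ^ a = 1) : g ^ b = g ^ c := by
  rw [← mul_inv_eq_one, ← zpow_sub]
  exact zpow_eq_one_of_dvd h hg

end Exponents

/-! ### Consequences of the relations when 3k = 0 -/

section Consequences

variable {n : ℕ} {Γ : Type*} [Group Γ] {k l : ZMod n} {x : ZMod n → Γ}

/-- The product `x_i x_{i+k} x_{i+2k}`. -/
def triple (k : ZMod n) (x : ZMod n → Γ) (i : ZMod n) : Γ :=
  x i * x (i + k) * x (i + 2 * k)

theorem triple_add_self (h3 : 3 * k = 0) (i : ZMod n) :
    triple k x (i + k) = (x i)⁻¹ * triple k x i * x i := by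
  have e₁ : i + k + k = i + 2 * k := by ring
  have e₂ : i + k + 2 * k = i := by linear_combination h3
  simp only [triple, e₁, e₂]; group

theorem IsTripleFamily.apply_add (hx : IsTripleFamily k l x) (i : ZMod n) :
    x (i + (k + l)) = (triple k x i)⁻¹ * x i := by
  have h := hx (i + k)
  rw [mul_eq_one_iff_eq_inv, show i + k + k = i + 2 * k by ring, ← inv_eq_iff_eq_inv,
    add_assoc] at h
  rw [← h, triple]; group

/-- Write W = xyz for the triple at i. The three factors at i + s are W⁻¹x, (x⁻¹W⁻¹x)y and
((xy)⁻¹W⁻¹xy)z; their product telescopes to W⁻³ · xyz = W⁻². -/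
theorem IsTripleFamily.triple_add (hx : IsTripleFamily k l x) (h3 : 3 * k = 0) (i : ZMod n) :
    triple k x (i + (k + l)) = triple k x i ^ (-2 : ℤ) := by
  have e₁ := hx.apply_add i
  have e₂ := hx.apply_add (i + k)
  have e₃ := hx.apply_add (i + k + k)
  rw [triple_add_self h3, triple_add_self h3] at e₃
  rw [triple_add_self h3] at e₂
  rw [triple, show i + (k + l) + k = i + k + (k + l) by ring,
    show i + (k + l) + 2 * k = i + k + k + (k + l) by ring, e₁, e₂, e₃]
  have e : triple k x i = x i * x (i + k) * x (i + k + k) := by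
    rw [triple, show i + 2 * k = i + k + k by ring]
  rw [show x (i + k + k) = (x (i + k))⁻¹ * (x i)⁻¹ * triple k x i by rw [e]; group]
  group

theorem IsTripleFamily.triple_add_mul (hx : IsTripleFamily k l x) (h3 : 3 * k = 0) (i : ZMod n)
    (j : ℕ) : triple k x (i + j * (k + l)) = triple k x i ^ ((-2 : ℤ) ^ j) := by
  induction j with
  | zero => simp
  | succ j ih =>
    rw [show i + ((j + 1 : ℕ) : ZMod n) * (k + l) = i + j * (k + l) + (k + l) by push_cast; ring,
      hx.triple_add h3, ih, ← zpow_mul, pow_succ]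

theorem IsTripleFamily.apply_add_mul (hx : IsTripleFamily k l x) (h3 : 3 * k = 0) (i : ZMod n)
    (j : ℕ) : x (i + j * (k + l)) = triple k x i ^ expo j * x i := by
  induction j with
  | zero => simp
  | succ j ih =>
    rw [show i + ((j + 1 : ℕ) : ZMod n) * (k + l) = i + j * (k + l) + (k + l) by push_cast; ring,
      hx.apply_add, ih, hx.triple_add_mul h3, ← mul_assoc, ← zpow_neg, ← zpow_add]
    congr 2
    -- The step adds -(-2)^j to the exponent; this matches the recursion because (-2)^j = 3 `expo j`
    -- + 1.
    have := three_mul_expo j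
    rw [expo_succ]; linarith

/-- After m steps of length k + l the index is back at i, so the accumulated power of W_i is
trivial. -/
theorem IsTripleFamily.triple_zpow_expo (hx : IsTripleFamily k l x) (h3 : 3 * k = 0)
    {m : ℕ} (hm : (m : ZMod n) * (k + l) = 0) (i : ZMod n) :
    triple k x i ^ expo m = 1 := by
  have h := hx.apply_add_mul h3 i m
  rw [hm, add_zero] at h
  exact right_eq_mul.1 h

end Consequences

/-! ### The cyclic case k = 0 -/

section Cyclic

/-- The homomorphism out of a cyclic group sending the generator to `g`. -/
def cycLift {N : ℕ} {Γ : Type*} [Group Γ] {g : Γ} (hg : g ^ (N : ℤ) = 1) : Cyc N →* Γ :=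
  AddMonoidHom.toMultiplicativeLeft
    (ZMod.lift N ⟨zmultiplesHom _ (Additive.ofMul g), by
      rw [zmultiplesHom_apply, ← ofMul_zpow, hg, ofMul_one]⟩)

theorem cycLift_ofAdd {N : ℕ} {Γ : Type*} [Group Γ] {g : Γ} (hg : g ^ (N : ℤ) = 1) (z : ℤ) :
    cycLift hg (Multiplicative.ofAdd (z : ZMod N)) = g ^ z := by
  simp [cycLift]

theorem cyc_hom_ext {N : ℕ} {Γ : Type*} [Group Γ] {f g : Cyc N →* Γ}
    (h : f (Multiplicative.ofAdd 1) = g (Multiplicative.ofAdd 1)) : f = g := by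
  refine MonoidHom.ext fun z => ?_
  obtain ⟨z, rfl⟩ := Multiplicative.ofAdd.surjective z
  obtain ⟨z, rfl⟩ := ZMod.intCast_surjective z
  rw [← zsmul_one, ofAdd_zsmul, map_zpow, map_zpow, h]

/-- The exponent of `s` modulo `n` representing `i`, when `s` is a unit modulo `n`. -/
def index {n : ℕ} (s i : ZMod n) : ℕ := (i * s⁻¹).val

theorem index_mul {n : ℕ} [NeZero n] {s : ZMod n} (hs : IsUnit s) (i : ZMod n) :
    (index s i : ZMod n) * s = i := by
  rw [index, ZMod.natCast_zmod_val, mul_assoc, ZMod.inv_mul_of_unit s hs, mul_one]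

theorem index_modEq {n : ℕ} [NeZero n] {s : ZMod n} (hs : IsUnit s) {i : ZMod n} {j : ℕ}
    (h : i = j * s) : index s i ≡ j [MOD n] := by
  rw [← ZMod.natCast_eq_natCast_iff]
  exact hs.mul_right_cancel ((index_mul hs i).trans h)

variable {n : ℕ} [NeZero n] {k l : ℤ}

theorem nonempty_mulEquiv_cyc (hk : (k : ZMod n) = 0) (hl : IsUnit (l : ZMod n)) :
    Nonempty (CyclicGroup n (word n k l) ≃* Cyc ((2 ^ n - (-1) ^ n : ℤ).toNat)) := by
  set N := (2 ^ n - (-1) ^ n : ℤ).toNat with hN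
  have hNZ : (N : ℤ) = (-1) ^ n * (3 * expo n) := by
    rw [hN, Int.toNat_of_nonneg (two_pow_sub_neg_one_pow_nonneg n), two_pow_sub_neg_one_pow]
  -- N = ±((-2)^n - 1), so -2 has order dividing n modulo N and x_{jl} ↦ (-2)^j is well defined.
  have key : ∀ {i j : ℕ}, i ≡ j [MOD n] → (((-2) ^ i : ℤ) : ZMod N) = ((-2) ^ j : ℤ) := by
    intro i j h
    rw [← sub_eq_zero, ← Int.cast_sub, ZMod.intCast_zmod_eq_zero_iff_dvd, hNZ,
      neg_one_pow_mul_dvd]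
    have h₁ := three_mul_expo i
    have h₂ := three_mul_expo j
    rw [show (-2 : ℤ) ^ i - (-2) ^ j = 3 * (expo i - expo j) by linarith]
    exact mul_dvd_mul_left 3 (expo_dvd_sub_of_modEq h)
  have hx : IsTripleFamily (k : ZMod n) (l : ZMod n)
      (fun i => (Multiplicative.ofAdd (((-2) ^ index (l : ZMod n) i : ℤ) : ZMod N) : Cyc N)) := by
    intro i
    have h : index (l : ZMod n) (i + l) ≡ index (l : ZMod n) i + 1 [MOD n] :=
      index_modEq hl (by push_cast; rw [add_mul, index_mul hl, one_mul])
    simp only [hk, add_zero]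
    rw [key h, ← ofAdd_add, ← ofAdd_add, ofAdd_eq_one]
    push_cast
    ring
  set x := gen n k l
  have hgen : ∀ (i : ZMod n), x (i + l) = x i ^ (-2 : ℤ) := by
    intro i
    have h := isTripleFamily_gen (n := n) k l i
    rw [hk, add_zero, mul_eq_one_iff_eq_inv, ← inv_eq_iff_eq_inv] at h
    change gen n k l _ = gen n k l _ ^ _
    rw [← h]; group
  have hpow : ∀ j : ℕ, x (j * l) = x 0 ^ ((-2 : ℤ) ^ j) := by
    intro j
    induction j with
    | zero => simp
    | succ j ih =>
      rw [Nat.cast_succ, add_mul, one_mul, hgen, ih, ← zpow_mul, pow_succ]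
  -- Going once around ℤ/n gives x_0^((-2)^n) = x_0.
  have hN1 : x 0 ^ (N : ℤ) = 1 := by
    have h := hpow n
    rw [ZMod.natCast_self, zero_mul] at h
    rw [hNZ, zpow_mul', three_mul_expo, zpow_sub_one, ← h, mul_inv_cancel, one_zpow]
  have hg := cycLift_ofAdd hN1
  refine ⟨(liftFamily hx).toMulEquiv (cycLift hN1) (hom_ext fun i => ?_) ?_⟩
  · rw [MonoidHom.comp_apply, liftFamily_gen, hg, ← hpow, index_mul hl]; rfl
  · have h0 : index (l : ZMod n) 0 ≡ 0 [MOD n] := index_modEq hl (by simp)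
    refine cyc_hom_ext ?_
    rw [MonoidHom.comp_apply, ← Int.cast_one, hg, map_zpow, liftFamily_gen, key h0]
    simp

end Cyclic

/-! ### The metacyclic case, with n = 3m and k = m(k + l) -/

section Metacyclic

variable {n m : ℕ}

/-- `(p ^ 2 + p + 1) / 3` for `p = (-2) ^ m`. -/
def cubeExpo (m : ℕ) : ℤ := 1 + 3 * expo m + 3 * expo m ^ 2

theorem expo_three_mul (m : ℕ) : expo (3 * m) = 3 * expo m * cubeExpo m := by
  rw [show 3 * m = m + (m + m) by ring, expo_add, expo_add,
    show (-2 : ℤ) ^ m = 3 * expo m + 1 by rw [three_mul_expo]; ring, cubeExpo]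
  ring

/-- With p = (-2)^m and c = (p² + p + 1)/3, the modulus is ±(p - 1)c and R - 1 = (p - 1)(p + 1).
Since 3c - p(p + 1) = 1, the gcd is |p - 1|, leaving c. -/
theorem metacyclic_quotient (hm : m ≠ 0) :
    (2 ^ (3 * m) - (-1) ^ (3 * m) : ℤ) / 3 /
      (Int.gcd ((2 ^ (3 * m) - (-1) ^ (3 * m)) / 3) (2 ^ (2 * (3 * m) / 3) - 1) : ℤ) =
      cubeExpo m := by
  have hp : (-2 : ℤ) ^ m = 3 * expo m + 1 := by rw [three_mul_expo]; ring
  have hR : (2 ^ (2 * (3 * m) / 3) - 1 : ℤ) = 3 * expo m * (3 * expo m + 2) := by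
    rw [show 2 * (3 * m) / 3 = m * 2 by omega, show (2 : ℤ) ^ (m * 2) = ((-2) ^ m) ^ 2 by
      rw [← pow_mul, mul_comm m 2, pow_mul, pow_mul]; norm_num, hp]
    ring
  have hco : Int.gcd ((-1) ^ (3 * m) * cubeExpo m) (3 * expo m + 2) = 1 := by
    rw [← Int.isCoprime_iff_gcd_eq_one]
    have h : IsCoprime (cubeExpo m) (3 * expo m + 2) :=
      ⟨3, -(3 * expo m + 1), by rw [cubeExpo]; ring⟩
    rcases neg_one_pow_eq_or ℤ (3 * m) with e | e <;> rw [e]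
    · rwa [one_mul]
    · rw [neg_one_mul]; exact h.neg_left
  have hpos : 0 < (-1) ^ m * (3 * expo m) := by
    rw [← two_pow_sub_neg_one_pow]; exact two_pow_sub_neg_one_pow_pos hm
  have habs : ((3 * expo m).natAbs : ℤ) = (-1) ^ m * (3 * expo m) := by
    rw [← abs_of_pos hpos, abs_mul, abs_neg_one_pow, one_mul, Int.natCast_natAbs]
  have h3 : ((-1) ^ (3 * m) : ℤ) = (-1) ^ m := by rw [pow_mul]; norm_num
  rw [hR, two_pow_sub_neg_one_pow_div_three, expo_three_mul,
    show (-1) ^ (3 * m) * (3 * expo m * cubeExpo m) =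
      3 * expo m * ((-1) ^ (3 * m) * cubeExpo m) by ring, Int.gcd_mul_left, hco, mul_one, habs, h3,
    show 3 * expo m * ((-1) ^ m * cubeExpo m) = (-1) ^ m * (3 * expo m) * cubeExpo m by ring,
    Int.mul_ediv_cancel_left _ hpos.ne']

theorem mul_zpow_of_conj_eq {Γ : Type*} [Group Γ] {a b : Γ} {R : ℤ} (h : b * a * b⁻¹ = a ^ R)
    (z : ℤ) : b * a ^ z = a ^ (R * z) * b := by
  rw [zpow_mul, ← h, conj_zpow]; group

/-- The elements `a ^ expo j * b` of a group satisfying the relations of the metacyclic group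
satisfy the relations of `G_n(x_0 x_k x_l)`. -/
theorem isTripleFamily_of_metacyclic [NeZero n] {Γ : Type*} [Group Γ] (hn : n = 3 * m) {k l : ZMod n}
    (hs : IsUnit (k + l)) (hk : k = m * (k + l)) {a b : Γ} (ha : a ^ expo n = 1)
    (hab : b * a * b⁻¹ = a ^ ((-2 : ℤ) ^ (2 * m))) (hb : b ^ 3 = a ^ cubeExpo m) :
    IsTripleFamily k l (fun i => a ^ expo (index (k + l) i) * b) := by
  intro i
  set j := index (k + l) i
  have hj : (j : ZMod n) * (k + l) = i := index_mul hs i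
  have h₁ : index (k + l) (i + k) ≡ j + m [MOD n] :=
    index_modEq hs (by push_cast; rw [add_mul, hj, ← hk])
  have hn0 : (3 * m : ZMod n) = 0 := by
    have := ZMod.natCast_self n
    rw [← this, ← Nat.cast_ofNat, ← Nat.cast_mul, ← hn]
  -- With s = k + l: l = s - k = (1 - m)s = (2m + 1)s, as 3m = 0.
  have h₂ : index (k + l) (i + l) ≡ j + (2 * m + 1) [MOD n] :=
    index_modEq hs (by push_cast; linear_combination (-1 : ZMod n) * hj - hk - (k + l) * hn0)
  have hcomm := mul_zpow_of_conj_eq hab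
  simp only
  rw [zpow_eq_zpow_of_dvd_sub (expo_dvd_sub_of_modEq h₁) ha,
    zpow_eq_zpow_of_dvd_sub (expo_dvd_sub_of_modEq h₂) ha]
  set R : ℤ := (-2) ^ (2 * m)
  calc a ^ expo j * b * (a ^ expo (j + m) * b) * (a ^ expo (j + (2 * m + 1)) * b)
      = a ^ expo j * (b * a ^ expo (j + m)) * (b * a ^ expo (j + (2 * m + 1))) * b := by group
    _ = a ^ expo j * a ^ (R * expo (j + m)) * (b * a ^ (R * expo (j + (2 * m + 1)))) * b * b := by
      rw [hcomm, hcomm]; group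
    _ = a ^ (expo j + R * expo (j + m) + R * (R * expo (j + (2 * m + 1)))) * b ^ 3 := by
      rw [hcomm, zpow_add, zpow_add, pow_succ, pow_two]; simp only [mul_assoc]
    _ = a ^ (expo j + R * expo (j + m) + R * (R * expo (j + (2 * m + 1))) + cubeExpo m) := by
      rw [hb, ← zpow_add]
    _ = 1 := by
      refine zpow_eq_one_of_dvd ?_ ha
      have hp : (-2 : ℤ) ^ m = 3 * expo m + 1 := by rw [three_mul_expo]; ring
      have hz : (-2 : ℤ) ^ j = 3 * expo j + 1 := by rw [three_mul_expo]; ring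
      have hR : R = (3 * expo m + 1) ^ 2 := by rw [← hp, ← pow_mul, mul_comm m 2]
      have h2m : expo (2 * m) = expo m + (3 * expo m + 1) * expo m := by
        rw [two_mul, expo_add, hp]
      -- For p = (-2)^m and z = (-2)^j, three times the exponent is (1 - p³)(z(1 + 2p³) + p), while
      -- 3 `expo n` = p³ - 1.
      refine ⟨-((-2) ^ j * (1 + 2 * (3 * expo m + 1) ^ 3) + (3 * expo m + 1)), ?_⟩
      rw [hn, expo_three_mul, ← add_assoc j, expo_succ, expo_add, expo_add, h2m, hR, hz, cubeExpo]
      ring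

theorem IsTripleFamily.metacyclic_relations {Γ : Type*} [Group Γ] (hn : n = 3 * m)
    {k l : ZMod n} (hk : k = m * (k + l)) {x : ZMod n → Γ} (hx : IsTripleFamily k l x) :
    triple k x 0 ^ expo n = 1 ∧
      x 0 * triple k x 0 * (x 0)⁻¹ = triple k x 0 ^ ((-2 : ℤ) ^ (2 * m)) ∧
      x 0 ^ 3 = triple k x 0 ^ cubeExpo m := by
  have hn0 : (3 * m : ZMod n) = 0 := by
    have := ZMod.natCast_self n
    rw [← this, ← Nat.cast_ofNat, ← Nat.cast_mul, ← hn]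
  have h3 : 3 * k = 0 := by rw [hk, ← mul_assoc, hn0, zero_mul]
  have hW := hx.triple_zpow_expo h3 (m := n) (by rw [ZMod.natCast_self, zero_mul]) 0
  have hp : (-2 : ℤ) ^ m = 3 * expo m + 1 := by rw [three_mul_expo]; ring
  have hR : (-2 : ℤ) ^ (2 * m) = (3 * expo m + 1) ^ 2 := by rw [← hp, ← pow_mul, mul_comm m 2]
  have h2m : expo (2 * m) = expo m + (3 * expo m + 1) * expo m := by
    rw [two_mul, expo_add, hp]
  have hconj : (x 0)⁻¹ * triple k x 0 * x 0 = triple k x 0 ^ ((-2 : ℤ) ^ m) := by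
    rw [← triple_add_self h3, ← hx.triple_add_mul h3, ← hk]
  have hx1 : x k = triple k x 0 ^ expo m * x 0 := by
    rw [← hx.apply_add_mul h3, ← hk, zero_add]
  have hx2 : x (2 * k) = triple k x 0 ^ expo (2 * m) * x 0 := by
    rw [← hx.apply_add_mul h3, zero_add]; push_cast; rw [mul_assoc, ← hk]
  have hWdef : triple k x 0 = x 0 * x k * x (2 * k) := by simp [triple]
  rw [hx1, hx2] at hWdef
  generalize triple k x 0 = w at *
  generalize x 0 = b at *
  have hab : b * w * b⁻¹ = w ^ ((-2 : ℤ) ^ (2 * m)) := by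
    -- Conjugation by b⁻¹ is the p-th power on w, p = (-2)^m. As w^(p³) = w, conjugation by b is the
    -- p²-th power.
    have h : w = w ^ ((-2 : ℤ) ^ m * (-2) ^ (2 * m)) := by
      conv_lhs => rw [← zpow_one w]
      refine zpow_eq_zpow_of_dvd_sub ⟨-3, ?_⟩ hW
      rw [← pow_add, show m + 2 * m = n by omega, mul_comm, neg_mul, three_mul_expo]; ring
    conv_lhs => rw [h, zpow_mul, ← hconj, ← conj_zpow]
    group
  refine ⟨hW, hab, ?_⟩
  have hcomm := mul_zpow_of_conj_eq hab
  set R : ℤ := (-2) ^ (2 * m)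
  -- Expanding w = x_0 x_k x_{2k} in terms of w and b and moving powers of w to the left determines
  -- b³.
  have h : w = w ^ (R * expo m + R * (R * expo (2 * m))) * b ^ 3 := by
    calc w = b * (w ^ expo m * b) * (w ^ expo (2 * m) * b) := hWdef
      _ = (b * w ^ expo m) * (b * w ^ expo (2 * m)) * b := by group
      _ = w ^ (R * expo m) * (b * w ^ (R * expo (2 * m))) * b * b := by rw [hcomm, hcomm]; group
      _ = _ := by rw [hcomm, zpow_add, pow_succ, pow_two]; simp only [mul_assoc]
  have h' : b ^ 3 = w ^ (1 - (R * expo m + R * (R * expo (2 * m)))) := by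
    rw [sub_eq_neg_add, zpow_add, zpow_one, zpow_neg, eq_inv_mul_iff_mul_eq, ← h]
  rw [h']
  refine zpow_eq_zpow_of_dvd_sub ?_ hW
  refine ⟨3 * expo m + 1 - 2 - (3 * expo m + 1) ^ 3, ?_⟩
  rw [hn, expo_three_mul, h2m, hR, cubeExpo]
  ring

/-- The generators correspond by a ↔ W_0 and b ↔ x_0, so that x_{js} ↔ a^(e_j) b with s = k + l. -/
theorem nonempty_mulEquiv_metacyclic [NeZero n] {k l : ℤ} (hn : n = 3 * m)
    (hs : IsUnit ((k : ZMod n) + l)) (hk : (k : ZMod n) = m * (k + l)) :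
    Nonempty (CyclicGroup n (word n k l) ≃*
      B ((2 ^ n - (-1) ^ n) / 3) 3 (2 ^ (2 * n / 3)) 1) := by
  have hm : m ≠ 0 := by
    have := NeZero.ne n
    omega
  have hM : ((2 ^ n - (-1) ^ n : ℤ) / 3) = (-1) ^ n * expo n :=
    two_pow_sub_neg_one_pow_div_three n
  have hR : (2 ^ (2 * n / 3) : ℤ) = (-2) ^ (2 * m) := by
    rw [hn, show 2 * (3 * m) / 3 = 2 * m by omega, pow_mul, pow_mul]; norm_num
  have hq : 1 * ((2 ^ n - (-1) ^ n : ℤ) / 3 /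
      (Int.gcd ((2 ^ n - (-1) ^ n) / 3) (2 ^ (2 * n / 3) - 1) : ℤ)) = cubeExpo m := by
    rw [one_mul, hn]; exact metacyclic_quotient hm
  have hrel : metacyclicRelators ((2 ^ n - (-1) ^ n) / 3) 3 (2 ^ (2 * n / 3)) 1 =
      {FreeGroup.of 0 ^ ((-1) ^ n * expo n),
        FreeGroup.of 1 * FreeGroup.of 0 * (FreeGroup.of 1)⁻¹ *
          (FreeGroup.of 0 ^ ((-2 : ℤ) ^ (2 * m)))⁻¹,
        FreeGroup.of 1 ^ (3 : ℤ) * (FreeGroup.of 0 ^ cubeExpo m)⁻¹} := by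
    rw [metacyclicRelators, hq, hM, hR]
  revert hrel
  change _ → Nonempty (_ ≃* PresentedGroup _)
  generalize metacyclicRelators ((2 ^ n - (-1) ^ n) / 3) 3 (2 ^ (2 * n / 3)) 1 = rels
  intro hrels
  let a : PresentedGroup rels := PresentedGroup.of 0
  let b : PresentedGroup rels := PresentedGroup.of 1
  have ha : a ^ expo n = 1 := by
    have h : a ^ ((-1) ^ n * expo n) = 1 := by
      have : PresentedGroup.mk rels (FreeGroup.of 0 ^ ((-1) ^ n * expo n)) = 1 :=
        PresentedGroup.one_of_mem (by simp [hrels])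
      rwa [map_zpow] at this
    exact zpow_eq_one_of_dvd ((neg_one_pow_mul_dvd _ _ _).2 dvd_rfl) h
  have hab : b * a * b⁻¹ = a ^ ((-2 : ℤ) ^ (2 * m)) := by
    have : PresentedGroup.mk rels (FreeGroup.of 1 * FreeGroup.of 0 * (FreeGroup.of 1)⁻¹ *
        (FreeGroup.of 0 ^ ((-2 : ℤ) ^ (2 * m)))⁻¹) = 1 :=
      PresentedGroup.one_of_mem (by simp [hrels])
    rw [map_mul, map_mul, map_mul, map_inv, map_inv, map_zpow] at this
    exact mul_inv_eq_one.1 this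
  have hb : b ^ 3 = a ^ cubeExpo m := by
    have : PresentedGroup.mk rels
        (FreeGroup.of 1 ^ (3 : ℤ) * (FreeGroup.of 0 ^ cubeExpo m)⁻¹) = 1 :=
      PresentedGroup.one_of_mem (by simp [hrels])
    rw [map_mul, map_inv, map_zpow, map_zpow] at this
    exact_mod_cast mul_inv_eq_one.1 this
  have hy := isTripleFamily_of_metacyclic hn hs hk ha hab hb
  set y : ZMod n → PresentedGroup rels := fun i => a ^ expo (index ((k : ZMod n) + (l : ZMod n)) i) * b
  have hx := isTripleFamily_gen (n := n) k l
  obtain ⟨hw₁, hw₂, hw₃⟩ := hx.metacyclic_relations hn hk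
  set x := gen n k l
  have hy_mul : ∀ j : ℕ, y (j * ((k : ZMod n) + (l : ZMod n))) = a ^ expo j * b := by
    intro j
    have h : index ((k : ZMod n) + (l : ZMod n)) (j * ((k : ZMod n) + (l : ZMod n))) ≡ j [MOD n] := index_modEq hs rfl
    simp only [y]
    rw [zpow_eq_zpow_of_dvd_sub (expo_dvd_sub_of_modEq h) ha]
  have hy0 : y 0 = b := by simpa using hy_mul 0
  -- Compare y_s = W⁻¹ y_0, where W is the triple of y at 0, with y_s = a⁻¹ b; here `expo 1` = -1.
  have hya : triple (k : ZMod n) y 0 = a := by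
    have h₁ := hy.apply_add 0
    have h₂ := hy_mul 1
    rw [zero_add, hy0] at h₁
    rw [Nat.cast_one, one_mul, h₁, expo_succ, expo_zero] at h₂
    simpa using h₂
  let g : PresentedGroup rels →* CyclicGroup n (word n k l) :=
    PresentedGroup.toGroup (f := ![triple (k : ZMod n) x 0, x 0]) (by
      intro r hr
      rw [hrels] at hr
      rcases hr with rfl | rfl | rfl
      · simpa using zpow_eq_one_of_dvd (Dvd.intro_left _ rfl) hw₁
      · simpa [mul_inv_eq_one] using hw₂
      · simpa [mul_inv_eq_one] using mod_cast hw₃)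
  have hga : g a = triple (k : ZMod n) x 0 := PresentedGroup.toGroup.of _
  have hgb : g b = x 0 := PresentedGroup.toGroup.of _
  have h3 : (3 : ZMod n) * k = 0 := by
    have := ZMod.natCast_self n
    rw [hk, ← mul_assoc, ← Nat.cast_ofNat, ← Nat.cast_mul, ← hn, this, zero_mul]
  refine ⟨(liftFamily hy).toMulEquiv g (hom_ext fun i => ?_) (PresentedGroup.ext fun i => ?_)⟩
  · rw [MonoidHom.comp_apply, liftFamily_gen, map_mul, map_zpow, hga, hgb,
      ← hx.apply_add_mul h3, zero_add, index_mul hs]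
    rfl
  · fin_cases i
    · change liftFamily hy (g a) = a
      rw [hga, triple, map_mul, map_mul, liftFamily_gen, liftFamily_gen, liftFamily_gen]
      exact hya
    · change liftFamily hy (g b) = b
      rw [hgb, liftFamily_gen, hy0]

end Metacyclic

/-! ### The free product case -/

section FreeProduct

variable {n m : ℕ}

theorem mint_hom_ext {Γ : Type*} [Group Γ] {f g : Multiplicative ℤ →* Γ}
    (h : f (Multiplicative.ofAdd 1) = g (Multiplicative.ofAdd 1)) : f = g :=
  MonoidHom.ext_mint h

theorem inv_mul_mul_zpow {Γ : Type*} [Group Γ] (g h : Γ) (e : ℤ) :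
    (g⁻¹ * h * g) ^ e = g⁻¹ * h ^ e * g := by
  simpa using conj_zpow (i := e) (a := g⁻¹) (b := h)

theorem triple_zpow_eq_one {n : ℕ} {Γ : Type*} [Group Γ] {k : ZMod n} (h3 : 3 * k = 0)
    {x : ZMod n → Γ} {e : ℤ} {i : ZMod n} (h : triple k x i ^ e = 1) :
    triple k x (i + k) ^ e = 1 := by
  rw [triple_add_self h3, inv_mul_mul_zpow, h]
  group

/-- The additive map `r ↦ r * k` on `ZMod 3`, for `k` killed by `3`. -/
def mulThree {k : ZMod n} (h3 : 3 * k = 0) : ZMod 3 →+ ZMod n :=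
  ZMod.lift 3 ⟨zmultiplesHom _ k, by simpa using h3⟩

theorem mulThree_intCast {k : ZMod n} (h3 : 3 * k = 0) (z : ℤ) :
    mulThree h3 (z : ZMod 3) = z * k := by
  simp [mulThree]

theorem mulThree_one {k : ZMod n} (h3 : 3 * k = 0) : mulThree h3 1 = k := by
  simpa using mulThree_intCast h3 1

theorem exists_eq_mul_add_mulThree [NeZero n] {k l : ℤ}
    (hco : ∃ u v w : ℤ, u * k + v * l + w * n = 1)
    (h3 : 3 * (k : ZMod n) = 0) (i : ZMod n) :
    ∃ (j : ℕ) (r : ZMod 3), i = j * ((k : ZMod n) + l) + mulThree h3 r := by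
  obtain ⟨u, v, w, h⟩ := hco
  obtain ⟨i, rfl⟩ := ZMod.intCast_surjective i
  -- Modulo n, 1 = uk + vl = v(k + l) + (u - v)k.
  refine ⟨((i * v : ℤ) : ZMod n).val, ((i * (u - v) : ℤ) : ZMod 3), ?_⟩
  rw [ZMod.natCast_zmod_val, mulThree_intCast]
  have h' := congrArg (Int.cast : ℤ → ZMod n) h
  push_cast at h' ⊢
  rw [ZMod.natCast_self] at h'
  linear_combination (-(i : ZMod n)) * h'

/-- Modulo 3 the term in k + l vanishes and k is invertible, which fixes r. Then (k + l)/3 is prime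
to m, which fixes j modulo m. Both coprimality witnesses rearrange the Bézout identity. -/
theorem index_unique (hn : n = 3 * m) {k l : ℤ}
    (hco : ∃ u v w : ℤ, u * k + v * l + w * n = 1) (h3 : 3 * (k : ZMod n) = 0)
    (hA : (3 : ℤ) ∣ k + l) {j j' : ℕ} {r r' : ZMod 3}
    (h : (j : ZMod n) * ((k : ZMod n) + l) + mulThree h3 r =
      j' * ((k : ZMod n) + l) + mulThree h3 r') : j ≡ j' [MOD m] ∧ r = r' := by
  obtain ⟨u, v, w, huvw⟩ := hco
  obtain ⟨σ, hσ⟩ := hA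
  have hr : r = r' := by
    obtain ⟨r, rfl⟩ := ZMod.intCast_surjective r
    obtain ⟨r', rfl⟩ := ZMod.intCast_surjective r'
    rw [mulThree_intCast, mulThree_intCast] at h
    have h₁ : (((j * (k + l) + r * k : ℤ)) : ZMod n) = ((j' * (k + l) + r' * k : ℤ)) := by
      push_cast; exact h
    rw [ZMod.intCast_eq_intCast_iff_dvd_sub, hn, hσ] at h₁
    rw [ZMod.intCast_eq_intCast_iff_dvd_sub]
    have h₂ : ((3 : ℕ) : ℤ) ∣ (r' - r) * k := by
      obtain ⟨c, hc⟩ := h₁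
      refine ⟨m * c - (j' - j) * σ, ?_⟩
      push_cast at hc ⊢
      linear_combination hc
    refine IsCoprime.dvd_of_dvd_mul_right ⟨v * σ + w * m, u - v, ?_⟩ h₂
    rw [hn] at huvw
    push_cast at huvw ⊢
    linear_combination huvw - v * hσ
  subst hr
  refine ⟨?_, rfl⟩
  have h₁ : (((j * (k + l) : ℤ)) : ZMod n) = ((j' * (k + l) : ℤ)) := by
    push_cast; exact add_right_cancel h
  rw [ZMod.intCast_eq_intCast_iff_dvd_sub, hn, hσ] at h₁
  have hk : (m : ℤ) ∣ k := by
    have h₂ : ((3 * k : ℤ) : ZMod n) = 0 := by push_cast; exact h3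
    rw [ZMod.intCast_zmod_eq_zero_iff_dvd, hn, Nat.cast_mul] at h₂
    exact Int.dvd_of_mul_dvd_mul_left (by norm_num) h₂
  obtain ⟨c, hc⟩ := hk
  rw [Nat.modEq_iff_dvd]
  have h₂ : (m : ℤ) ∣ (j' - j) * σ := by
    obtain ⟨d, hd⟩ := h₁
    refine ⟨d, ?_⟩
    push_cast at hd
    linarith
  refine IsCoprime.dvd_of_dvd_mul_right ⟨(u - v) * c + w * 3, 3 * v, ?_⟩ h₂
  rw [hn] at huvw
  push_cast at huvw ⊢
  linear_combination huvw - v * hσ - (u - v) * hc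

/-- The hypotheses on H say that it behaves as ⟨w, a, b | w^(e_m) = 1⟩. The correspondence is w ↔
W_0, a ↔ x_0, b ↔ x_k. -/
theorem nonempty_mulEquiv_of_universal [NeZero n] (hn : n = 3 * m) {k l : ℤ}
    (hco : ∃ u v w : ℤ, u * k + v * l + w * n = 1) (h3 : 3 * (k : ZMod n) = 0)
    (hA : (3 : ℤ) ∣ k + l) {H : Type*} [Group H] {w a b : H} (hw : w ^ expo m = 1)
    (hlift : ∀ w' a' b' : CyclicGroup n (word n k l), w' ^ expo m = 1 →
      ∃ g : H →* CyclicGroup n (word n k l), g w = w' ∧ g a = a' ∧ g b = b')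
    (hext : ∀ f : H →* H, f w = w → f a = a → f b = b → f = MonoidHom.id H) :
    Nonempty (CyclicGroup n (word n k l) ≃* H) := by
  -- Images of x_0, x_k, x_{2k}; the third is forced by the product being w.
  let c : ZMod 3 → H := ![a, b, (a * b)⁻¹ * w]
  have hc0 : c 0 = a := rfl
  have hc1 : c 1 = b := rfl
  have hc2 : c 2 = (a * b)⁻¹ * w := rfl
  have h30 : (3 : ZMod 3) * 1 = 0 := rfl
  have hV0 : triple 1 c 0 = w := by
    change c 0 * c 1 * c 2 = w
    rw [hc0, hc1, hc2, mul_inv_cancel_left]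
  have hV : ∀ r, triple 1 c r ^ expo m = 1 := by
    have e₀ : triple 1 c 0 ^ expo m = 1 := by rw [hV0, hw]
    have e₁ := triple_zpow_eq_one h30 e₀
    have e₂ := triple_zpow_eq_one h30 e₁
    intro r
    fin_cases r
    exacts [e₀, e₁, e₂]
  choose J r hJr using exists_eq_mul_add_mulThree hco h3
  let y : ZMod n → H := fun i => triple 1 c (r i) ^ expo (J i) * c (r i)
  have hyval : ∀ (i : ZMod n) (j : ℕ) (q : ZMod 3),
      i = j * ((k : ZMod n) + l) + mulThree h3 q → y i = triple 1 c q ^ expo j * c q := by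
    intro i j q h
    obtain ⟨h₁, h₂⟩ := index_unique hn hco h3 hA ((hJr i).symm.trans h)
    simp only [y, h₂]
    rw [zpow_eq_zpow_of_dvd_sub (expo_dvd_sub_of_modEq h₁) (hV q)]
  have hy : IsTripleFamily (k : ZMod n) (l : ZMod n) y := by
    intro i
    have hi := hJr i
    set j := J i
    set q := r i
    have h₁ : i + k = j * ((k : ZMod n) + l) + mulThree h3 (q + 1) := by
      rw [map_add, mulThree_one, ← add_assoc, ← hi]
    -- l = (k + l) - k = (k + l) + 2k, as 3k = 0.
    have h₂ : i + l = (j + 1 : ℕ) * ((k : ZMod n) + l) + mulThree h3 (q + 1 + 1) := by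
      rw [map_add, map_add, mulThree_one]
      push_cast
      linear_combination hi - h3
    rw [hyval i j q hi, hyval _ _ _ h₁, hyval _ _ _ h₂, triple_add_self h30, triple_add_self h30,
      inv_mul_mul_zpow, inv_mul_mul_zpow, triple_add_self h30, inv_mul_mul_zpow]
    have hVq : c (q + 1 + 1) = (c (q + 1))⁻¹ * (c q)⁻¹ * triple 1 c q := by
      rw [triple, show q + 2 * 1 = q + 1 + 1 by ring]; group
    -- For v the triple of c at q, the product telescopes to v^(2e_j + e_{j+1} + 1), whose exponent
    -- is 0 by the recursion.
    rw [hVq, expo_succ]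
    generalize triple 1 c q = v
    group
  set x := gen n k l with hxdef
  have hx : IsTripleFamily (k : ZMod n) (l : ZMod n) x := isTripleFamily_gen k l
  have hxm : triple (k : ZMod n) x 0 ^ expo m = 1 := by
    refine hx.triple_zpow_expo h3 ?_ 0
    obtain ⟨σ, hσ⟩ := hA
    rw [← Int.cast_add, hσ, ← Int.cast_natCast, ← Int.cast_mul,
      ZMod.intCast_zmod_eq_zero_iff_dvd]
    exact ⟨σ, by rw [hn]; push_cast; ring⟩
  obtain ⟨g, hgw, hga, hgb⟩ := hlift _ (x 0) (x k) hxm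
  have hgc : ∀ q, g (c q) = x (mulThree h3 q) := by
    intro q
    have e₂ : mulThree h3 2 = 2 * (k : ZMod n) := by simpa using mulThree_intCast h3 2
    fin_cases q
    · change g (c 0) = x (mulThree h3 0)
      rw [hc0, hga, map_zero]
    · change g (c 1) = x (mulThree h3 1)
      rw [hc1, hgb, mulThree_one]
    · change g (c 2) = x (mulThree h3 2)
      rw [hc2, map_mul, map_inv, map_mul, hgw, hga, hgb, e₂, triple, zero_add, zero_add]
      group
  have hgV : ∀ q, g (triple 1 c q) = triple (k : ZMod n) x (mulThree h3 q) := by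
    intro q
    have e₂ : mulThree h3 (2 * 1) = 2 * (k : ZMod n) := by simpa using mulThree_intCast h3 2
    rw [triple, map_mul, map_mul, hgc, hgc, hgc, map_add, map_add, mulThree_one, e₂, triple]
  have hy0 : y 0 = a := by simpa [hc0] using hyval 0 0 0 (by simp)
  have hy1 : y k = b := by simpa [hc1] using hyval k 0 1 (by simp [mulThree_one])
  have hy2 : y (2 * k) = c 2 := by
    simpa using hyval (2 * k) 0 2 (by simpa using (mulThree_intCast h3 2).symm)
  refine ⟨(liftFamily hy).toMulEquiv g (hom_ext fun i => ?_) ?_⟩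
  · rw [MonoidHom.comp_apply, liftFamily_gen, map_mul, map_zpow, hgV, hgc,
      ← hx.apply_add_mul h3, add_comm, ← hJr]
    rfl
  · refine hext _ ?_ ?_ ?_
    · change liftFamily hy (g w) = w
      rw [hgw, triple, map_mul, map_mul, liftFamily_gen, liftFamily_gen, liftFamily_gen, zero_add,
        zero_add, hy0, hy1, hy2, hc2, mul_inv_cancel_left]
    · change liftFamily hy (g a) = a
      rw [hga, liftFamily_gen, hy0]
    · change liftFamily hy (g b) = b
      rw [hgb, liftFamily_gen, hy1]

theorem nonempty_mulEquiv_coprod [NeZero n] (hn : n = 3 * m) {k l : ℤ}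
    (hco : ∃ u v w : ℤ, u * k + v * l + w * n = 1) (h3 : 3 * (k : ZMod n) = 0)
    (hA : (3 : ℤ) ∣ k + l) :
    Nonempty (CyclicGroup n (word n k l) ≃*
      Monoid.Coprod
        (Monoid.Coprod (Cyc (((2 ^ (n / 3) - (-1) ^ (n / 3)) / 3 : ℤ).toNat))
          (Multiplicative ℤ))
        (Multiplicative ℤ)) := by
  rw [show n / 3 = m by omega]
  set Q := ((2 ^ m - (-1) ^ m) / 3 : ℤ).toNat with hQdef
  have hQ : (Q : ℤ) = (-1) ^ m * expo m := by
    rw [hQdef, Int.toNat_of_nonneg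
      (Int.ediv_nonneg (two_pow_sub_neg_one_pow_nonneg m) (by norm_num)),
      two_pow_sub_neg_one_pow_div_three]
  clear_value Q
  have hgenQ : (Multiplicative.ofAdd 1 : Cyc Q) ^ expo m = 1 := by
    refine zpow_eq_one_of_dvd (a := Q) (by rw [hQ, neg_one_pow_mul_dvd]) ?_
    rw [← ofAdd_zsmul]
    simp
  refine nonempty_mulEquiv_of_universal hn hco h3 hA
    (H := Monoid.Coprod (Monoid.Coprod (Cyc Q) (Multiplicative ℤ)) (Multiplicative ℤ))
    (w := Monoid.Coprod.inl (Monoid.Coprod.inl (Multiplicative.ofAdd 1)))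
    (a := Monoid.Coprod.inl (Monoid.Coprod.inr (Multiplicative.ofAdd 1)))
    (b := Monoid.Coprod.inr (Multiplicative.ofAdd 1)) ?_ ?_ ?_
  · let ι : Cyc Q →* Monoid.Coprod (Monoid.Coprod (Cyc Q) (Multiplicative ℤ))
        (Multiplicative ℤ) := Monoid.Coprod.inl.comp Monoid.Coprod.inl
    exact (map_zpow ι _ _).symm.trans ((congrArg ι hgenQ).trans (map_one ι))
  · intro w' a' b' hw'
    have hwQ : w' ^ (Q : ℤ) = 1 :=
      zpow_eq_one_of_dvd (by rw [hQ]; exact Dvd.intro_left _ rfl) hw'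
    refine ⟨Monoid.Coprod.lift
      (Monoid.Coprod.lift (cycLift hwQ) (zpowersHom _ a')) (zpowersHom _ b'), ?_, ?_, ?_⟩
    · have h := cycLift_ofAdd hwQ 1
      rw [Int.cast_one, zpow_one] at h
      exact h
    · exact zpow_one a'
    · exact zpow_one b'
  · intro f hw ha hb
    let ι₁ : Cyc Q →* Monoid.Coprod (Monoid.Coprod (Cyc Q) (Multiplicative ℤ))
        (Multiplicative ℤ) := Monoid.Coprod.inl.comp Monoid.Coprod.inl
    let ι₂ : Multiplicative ℤ →* Monoid.Coprod (Monoid.Coprod (Cyc Q) (Multiplicative ℤ))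
        (Multiplicative ℤ) := Monoid.Coprod.inl.comp Monoid.Coprod.inr
    let ι₃ : Multiplicative ℤ →* Monoid.Coprod (Monoid.Coprod (Cyc Q) (Multiplicative ℤ))
        (Multiplicative ℤ) := Monoid.Coprod.inr
    have h₁ : f.comp ι₁ = ι₁ := cyc_hom_ext hw
    have h₂ : f.comp ι₂ = ι₂ := mint_hom_ext ha
    have h₃ : f.comp ι₃ = ι₃ := mint_hom_ext hb
    exact Monoid.Coprod.hom_ext (Monoid.Coprod.hom_ext h₁ h₂) h₃

end FreeProduct

/-! ### The three cases under divisibility hypotheses on k -/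

section Cases

variable {n : ℕ} {k l : ℤ}

theorem exists_bezout (hgcd : Nat.gcd n (Int.gcd k l) = 1) :
    ∃ u v w : ℤ, u * k + v * l + w * n = 1 := by
  have h₁ := Nat.gcd_eq_gcd_ab n (Int.gcd k l)
  have h₂ := Int.gcd_eq_gcd_ab k l
  rw [hgcd, h₂] at h₁
  set A := Nat.gcdA n (Int.gcd k l)
  set C := Nat.gcdB n (Int.gcd k l)
  refine ⟨Int.gcdA k l * C, Int.gcdB k l * C, A, ?_⟩
  push_cast at h₁
  linarith

theorem bezout_rotate (h : ∃ u v w : ℤ, u * k + v * l + w * n = 1) :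
    ∃ u v w : ℤ, u * (l - k) + v * (-k) + w * n = 1 := by
  obtain ⟨u, v, w, h⟩ := h
  exact ⟨v, -(u + v), w, by linarith⟩

theorem cyc_of_dvd [NeZero n] (h : ∃ u v w : ℤ, u * k + v * l + w * n = 1) (hk : (n : ℤ) ∣ k) :
    Nonempty (CyclicGroup n (word n k l) ≃* Cyc ((2 ^ n - (-1) ^ n : ℤ).toNat)) := by
  have hk0 : (k : ZMod n) = 0 := (ZMod.intCast_zmod_eq_zero_iff_dvd k n).2 hk
  refine nonempty_mulEquiv_cyc hk0 ?_
  obtain ⟨u, v, w, h⟩ := h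
  have h' := congrArg (Int.cast : ℤ → ZMod n) h
  push_cast at h'
  rw [hk0, ZMod.natCast_self, mul_zero, mul_zero, zero_add, add_zero] at h'
  exact IsUnit.of_mul_eq_one_right _ h'

theorem three_dvd_of_not_dvd (h3 : (n : ℤ) ∣ 3 * k) (hk : ¬ (n : ℤ) ∣ k) : 3 ∣ n := by
  by_contra h
  have hco : IsCoprime (n : ℤ) 3 := by
    rw [Int.isCoprime_iff_gcd_eq_one]
    exact ((Nat.Prime.coprime_iff_not_dvd Nat.prime_three).2 h).symm
  exact hk (hco.dvd_of_dvd_mul_left h3)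

theorem metacyclic_of_dvd [NeZero n] (h : ∃ u v w : ℤ, u * k + v * l + w * n = 1)
    (h3 : (n : ℤ) ∣ 3 * k) (hk : ¬ (n : ℤ) ∣ k) (hA : ¬ (3 : ℤ) ∣ k + l) :
    Nonempty (CyclicGroup n (word n k l) ≃*
      B ((2 ^ n - (-1) ^ n) / 3) 3 (2 ^ (2 * n / 3)) 1) := by
  obtain ⟨m, hn⟩ := three_dvd_of_not_dvd h3 hk
  obtain ⟨c, hc⟩ : (m : ℤ) ∣ k := by
    rw [hn, Nat.cast_mul] at h3
    exact Int.dvd_of_mul_dvd_mul_left (by norm_num) h3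
  obtain ⟨u, v, w, huvw⟩ := h
  have hnZ : (n : ℤ) = 3 * m := by rw [hn]; push_cast; rfl
  -- k + l is prime to 3 because (A) fails, and to m because m divides k and gcd(n, k, l) = 1.
  have hcop : IsCoprime (k + l) (n : ℤ) := by
    rw [hnZ]
    refine IsCoprime.mul_right ?_ ⟨v, (u - v) * c + 3 * w, ?_⟩
    · exact ((Prime.coprime_iff_not_dvd Int.prime_three).2 hA).symm
    · linear_combination huvw - (u - v) * hc - w * hnZ
  obtain ⟨y, z, hyz⟩ := hcop
  have hyz' : (y : ZMod n) * (k + l) = 1 := by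
    have := congrArg (Int.cast : ℤ → ZMod n) hyz
    push_cast at this
    rwa [ZMod.natCast_self, mul_zero, add_zero] at this
  have hs : IsUnit ((k : ZMod n) + l) := IsUnit.of_mul_eq_one_right _ hyz'
  have hn0 : (3 * m : ZMod n) = 0 := by
    have := ZMod.natCast_self n
    rw [← this, ← Nat.cast_ofNat, ← Nat.cast_mul, ← hn]
  have hkc : (k : ZMod n) = m * c := by rw [hc]; push_cast; rfl
  -- k = mc = (yc) · m(k + l), and 3m = 0, so only yc mod 3 matters. Residue 0 would give k = 0;
  -- residue -1 is turned into 1 by inverting the generators.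
  have hkeq : ∀ d : ℤ, (3 : ℤ) ∣ y * c - d → (k : ZMod n) = d * (m * (k + l)) := by
    rintro d ⟨q, hq⟩
    have hq' := congrArg (Int.cast : ℤ → ZMod n) hq
    push_cast at hq'
    linear_combination (-(k : ZMod n)) * hyz' + y * (k + l) * hkc + m * (k + l) * hq' +
      q * (k + l) * hn0
  have hcases : (3 : ℤ) ∣ y * c - 0 ∨ (3 : ℤ) ∣ y * c - 1 ∨ (3 : ℤ) ∣ y * c - (-1) := by omega
  rcases hcases with hd | hd | hd
  · refine absurd ?_ hk
    rw [← ZMod.intCast_zmod_eq_zero_iff_dvd, hkeq 0 hd]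
    simp
  · refine nonempty_mulEquiv_metacyclic hn hs ?_
    simpa using hkeq 1 hd
  · obtain ⟨e⟩ := nonempty_mulEquiv_inv (n := n) k l
    have hs' : (((-k : ℤ) : ZMod n) + ((l - k : ℤ) : ZMod n)) = k + l := by
      push_cast
      linear_combination (-3 : ZMod n) * hkc - c * hn0
    obtain ⟨f⟩ := nonempty_mulEquiv_metacyclic (k := -k) (l := l - k) hn (by rwa [hs']) (by
      rw [hs']
      have := hkeq (-1) hd
      push_cast at this ⊢
      linear_combination -this)
    exact ⟨e.trans f⟩

theorem coprod_of_dvd [NeZero n] (h : ∃ u v w : ℤ, u * k + v * l + w * n = 1)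
    (h3 : (n : ℤ) ∣ 3 * k) (hA : CondA n k l) :
    Nonempty (CyclicGroup n (word n k l) ≃*
      Monoid.Coprod
        (Monoid.Coprod (Cyc (((2 ^ (n / 3) - (-1) ^ (n / 3)) / 3 : ℤ).toNat))
          (Multiplicative ℤ))
        (Multiplicative ℤ)) := by
  obtain ⟨m, hn⟩ : 3 ∣ n := by exact_mod_cast Int.modEq_zero_iff_dvd.1 hA.1
  refine nonempty_mulEquiv_coprod hn h ?_ (Int.modEq_zero_iff_dvd.1 hA.2)
  rw [← ZMod.intCast_zmod_eq_zero_iff_dvd] at h3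
  exact_mod_cast h3

theorem condA_rotate : CondA n (l - k) (-k) ↔ CondA n k l := by
  simp only [CondA, Int.modEq_zero_iff_dvd]
  have : (3 : ℤ) ∣ l - k + -k ↔ (3 : ℤ) ∣ k + l := by omega
  rw [this]

end Cases

end CyclicPres

/-! ### Reduction of the general statement to the case 3k = 0 -/

theorem corollaryD (n : ℕ) (hn : 0 < n) (k l : ℤ)
    (hgcd : Nat.gcd n (Int.gcd k l) = 1) (hC : CyclicPres.CondC n k l) :
    (¬ CyclicPres.CondA n k l → ¬ k ≡ 0 [ZMOD n] → ¬ l ≡ 0 [ZMOD n] → ¬ k ≡ l [ZMOD n] →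
      Nonempty (CyclicPres.CyclicGroup n (CyclicPres.word n k l) ≃*
        CyclicPres.B ((2 ^ n - (-1) ^ n) / 3) 3 (2 ^ (2 * n / 3)) 1)) ∧
    (k ≡ 0 [ZMOD n] ∨ l ≡ 0 [ZMOD n] ∨ k ≡ l [ZMOD n] →
      Nonempty (CyclicPres.CyclicGroup n (CyclicPres.word n k l) ≃*
        CyclicPres.Cyc ((2 ^ n - (-1) ^ n : ℤ).toNat))) ∧
    (CyclicPres.CondA n k l →
      Nonempty (CyclicPres.CyclicGroup n (CyclicPres.word n k l) ≃*
        Monoid.Coprod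
          (Monoid.Coprod (CyclicPres.Cyc (((2 ^ (n / 3) - (-1) ^ (n / 3)) / 3 : ℤ).toNat))
            (Multiplicative ℤ))
          (Multiplicative ℤ))) := by
  open CyclicPres in
  have : NeZero n := ⟨hn.ne'⟩
  have hco := exists_bezout hgcd
  have hco₁ := bezout_rotate hco
  have hco₂ := bezout_rotate hco₁
  -- The first parameter of the successive rotations is k, l - k, -l, so each alternative of (C), or
  -- of the cyclic case, becomes a condition on the first parameter.
  obtain ⟨e₁⟩ := nonempty_mulEquiv_rotate (n := n) k l
  obtain ⟨e₂⟩ := nonempty_mulEquiv_rotate (n := n) (l - k) (-k)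
  have hdvd₁ : k ≡ l [ZMOD n] ↔ (n : ℤ) ∣ l - k := Int.modEq_iff_dvd
  have hdvd₂ : (n : ℤ) ∣ -k - (l - k) ↔ (n : ℤ) ∣ l := by
    rw [show -k - (l - k) = -l by ring, dvd_neg]
  have hdvd₃ : (n : ℤ) ∣ 3 * (-k - (l - k)) ↔ (n : ℤ) ∣ 3 * l := by
    rw [show 3 * (-k - (l - k)) = -(3 * l) by ring, dvd_neg]
  simp only [CondC, Int.modEq_zero_iff_dvd] at hC
  rw [hdvd₁, Int.modEq_zero_iff_dvd, Int.modEq_zero_iff_dvd]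
  refine ⟨fun hA hk hl hkl => ?_, ?_, fun hA => ?_⟩
  · have hn3 : 3 ∣ n := by
      rcases hC with h | h | h
      · exact three_dvd_of_not_dvd h hl
      · exact three_dvd_of_not_dvd h hk
      · exact three_dvd_of_not_dvd h hkl
    have hA' : ¬ (3 : ℤ) ∣ k + l := fun h => hA ⟨Int.modEq_zero_iff_dvd.2 (by exact_mod_cast hn3),
      Int.modEq_zero_iff_dvd.2 h⟩
    rcases hC with h | h | h
    · obtain ⟨f⟩ := metacyclic_of_dvd hco₂ (hdvd₃.2 h) (fun h => hl (hdvd₂.1 h)) (by omega)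
      exact ⟨(e₁.trans e₂).trans f⟩
    · exact metacyclic_of_dvd hco h hk hA'
    · obtain ⟨f⟩ := metacyclic_of_dvd hco₁ h hkl (by omega)
      exact ⟨e₁.trans f⟩
  · rintro (h | h | h)
    · exact cyc_of_dvd hco h
    · obtain ⟨f⟩ := cyc_of_dvd hco₂ (hdvd₂.2 h)
      exact ⟨(e₁.trans e₂).trans f⟩
    · obtain ⟨f⟩ := cyc_of_dvd hco₁ h
      exact ⟨e₁.trans f⟩
  · have hA₁ := condA_rotate.2 hA
    rcases hC with h | h | h
    · obtain ⟨f⟩ := coprod_of_dvd hco₂ (hdvd₃.2 h) (condA_rotate.2 hA₁)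
      exact ⟨(e₁.trans e₂).trans f⟩
    · exact coprod_of_dvd hco h hA
    · obtain ⟨f⟩ := coprod_of_dvd hco₁ h hA₁
      exact ⟨e₁.trans f⟩
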